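/- Let $d,n,D\ge 1$ be integers. For $\mathbf A\in\mathbb R^{d\times D}$ with columns $\mathbf a_1,\dots,\mathbf a_D$ let $\beta_{\mathbf A}:\mathbb R^{n\times d}\to\mathbb R^{n\times D}$ be the map for which the $k$-th column of $\beta_{\mathbf A}(\mathbf X)$ is the vector $\mathbf X\mathbf a_k$ with its entries sorted in non-decreasing order. Let $S_n$ act on $\mathbb R^{n\times d}$ by permuting rows and put $\operatorname{dist}(\mathbf X,\mathbf Y)=\min_{\sigma\in S_n}\|\mathbf X-\sigma\mathbf Y\|_{\mathrm F}$. The lower and the upper Lipschitz constant of the induced map $\bar\beta_{\mathbf A}$ on $\mathbb R^{n\times d}/S_n$ are the largest $C_1\ge 0$ and the smallest $C_2\ge 0$ such that $$C_1\operatorname{dist}(\mathbf X,\mathbf Y)\le\|\beta_{\mathbf A}(\mathbf X)-\beta_{\mathbf A}(\mathbf Y)\|_{\mathrm F}\le C_2\operatorname{dist}(\mathbf X,\mathbf Y)\qquad\text{for all }\mathbf X,\mathbf Y\in\mathbb R^{n\times d},$$ and, if $C_1>0$, the distortion of $\bar\beta_{\mathbf A}$ is $C_2/C_1$. Let $\mathbf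 A\in\mathbb R^{d\times D}$ be a random matrix whose columns are independent and uniformly distributed on the unit sphere $S^{d-1}$, and suppose that $$D\ge 18\,d\,n^2\log\left(\frac{48\sqrt3\,n\sqrt{d+3\log(\sqrt6\,n)}}{\sqrt\pi}+1\right).$$ Then, with probability at least $1-\exp(-D/(18n^2))$, the lower Lipschitz constant of $\bar\beta_{\mathbf A}$ is at least $$\frac{\sqrt\pi}{24\sqrt3}\,\bigl(d+3\log(\sqrt6\,n)\bigr)^{-1/2}\,\frac{\sqrt D}{n^2}.$$ Moreover, there is a function $f:\mathbb N\to\mathbb R$, not depending on $d$ or $D$, with $f(n)\in\widetilde O(n^2)$ (that is, $f(n)\in O(n^2\log^m n)$ as $n\to\infty$ for some natural number $m$), such that for all $d,n,D$ and $\mathbf A$ as above, with probability at least $1-2\exp(-D)-\exp(-D/(18n^2))$, the lower Lipschitz constant is positive and the distortion of $\bar\beta_{\mathbf A}$ is at most $f(n)$. -/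

import Mathlib

noncomputable section

namespace SortEmbedding

open MeasureTheory ProbabilityTheory Filter Asymptotics
open scoped Matrix Matrix.Norms.Frobenius

/-- The entries of a vector rearranged in non-decreasing order. -/
def sortVec {n : ℕ} (v : Fin n → ℝ) : Fin n → ℝ := v ∘ Tuple.sort v

/-- The sorting embedding `β_A : ℝ^{n × d} → ℝ^{n × D}`: the `k`-th column of `β_A(X)` is the sorted
vector `X a_k`, where `a_k` is the `k`-th column of `A`. -/
def beta {n d D : ℕ} (A : Matrix (Fin d) (Fin D) ℝ) (X : Matrix (Fin n) (Fin d) ℝ) :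
    Matrix (Fin n) (Fin D) ℝ :=
  Matrix.of fun i k => sortVec (X *ᵥ fun j => A j k) i

/-- The quotient metric `min_σ ‖X - σ Y‖_F`, where row `i` of `σ Y` is row `σ i` of `Y`
and the norm is the Frobenius norm. -/
def orbitDist {n d : ℕ} (X Y : Matrix (Fin n) (Fin d) ℝ) : ℝ :=
  ⨅ σ : Equiv.Perm (Fin n), ‖X - Y.submatrix σ id‖

/-- The lower Lipschitz constant of the map induced by `β_A` on `ℝ^{n × d} / S_n`: the largest `C ≥ 0`
with `C * dist(X, Y) ≤ ‖β_A(X) - β_A(Y)‖_F` for all `X`, `Y`. -/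
def lowerLip (n : ℕ) {d D : ℕ} (A : Matrix (Fin d) (Fin D) ℝ) : ℝ :=
  sSup {C : ℝ | 0 ≤ C ∧ ∀ X Y : Matrix (Fin n) (Fin d) ℝ,
    C * orbitDist X Y ≤ ‖beta A X - beta A Y‖}

/-- The upper Lipschitz constant of the map induced by `β_A` on `ℝ^{n × d} / S_n`: the smallest `C ≥ 0`
with `‖β_A(X) - β_A(Y)‖_F ≤ C * dist(X, Y)` for all `X`, `Y`. -/
def upperLip (n : ℕ) {d D : ℕ} (A : Matrix (Fin d) (Fin D) ℝ) : ℝ :=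
  sInf {C : ℝ | 0 ≤ C ∧ ∀ X Y : Matrix (Fin n) (Fin d) ℝ,
    ‖beta A X - beta A Y‖ ≤ C * orbitDist X Y}

/-- The distortion, meaningful when `0 < lowerLip n A`. -/
def distortion (n : ℕ) {d D : ℕ} (A : Matrix (Fin d) (Fin D) ℝ) : ℝ :=
  upperLip n A / lowerLip n A

/-- The uniform probability distribution on the unit sphere `S^{d-1}` (for `d ≥ 1`), as a measure
on `ℝ^d`: the normalized surface measure. -/
def sphereUniform (d : ℕ) : Measure (EuclideanSpace ℝ (Fin d)) :=
  let s := (volume : Measure (EuclideanSpace ℝ (Fin d))).toSphere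
  ((s Set.univ)⁻¹ • s).map Subtype.val

/-- The random matrix `A` has independent columns, each uniformly distributed on the unit sphere. -/
def HasIndepUniformSphereColumns {Ω : Type*} [MeasurableSpace Ω] {d D : ℕ}
    (A : Ω → Matrix (Fin d) (Fin D) ℝ) (P : Measure Ω) : Prop :=
  (∀ k : Fin D, HasLaw (fun ω => WithLp.toLp 2 fun j => A ω j k) (sphereUniform d) P) ∧
    iIndepFun (fun (k : Fin D) (ω : Ω) => WithLp.toLp 2 fun j : Fin d => A ω j k) P

/-- `f ∈ Õ(g)`: `f ∈ O(g log^m)` for some natural number `m`. -/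
def IsSoftO (f g : ℕ → ℝ) : Prop :=
  ∃ m : ℕ, f =O[atTop] fun n => g n * Real.log n ^ m

end SortEmbedding

end

noncomputable section

namespace SortEmbedding

open MeasureTheory ProbabilityTheory Filter Asymptotics
open scoped Matrix Matrix.Norms.Frobenius Pointwise

/-- The `k`-th column of `A` as a Euclidean vector. -/
def colVec {d D : ℕ} (A : Matrix (Fin d) (Fin D) ℝ) (k : Fin D) : EuclideanSpace ℝ (Fin d) :=
  WithLp.toLp 2 fun j => A j k

/-- The `i`-th row of `X` as a Euclidean vector. -/
def rowVec {n d : ℕ} (X : Matrix (Fin n) (Fin d) ℝ) (i : Fin n) : EuclideanSpace ℝ (Fin d) :=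
  WithLp.toLp 2 fun j => X i j

lemma mulVec_col_eq_inner {n d D : ℕ} (A : Matrix (Fin d) (Fin D) ℝ)
    (X : Matrix (Fin n) (Fin d) ℝ) (i : Fin n) (k : Fin D) :
    (X *ᵥ fun j => A j k) i = inner ℝ (rowVec X i) (colVec A k) := by
  simp [Matrix.mulVec, dotProduct, rowVec, colVec, PiLp.inner_apply, mul_comm]

lemma frobenius_norm_sq {m n : ℕ} (M : Matrix (Fin m) (Fin n) ℝ) :
    ‖M‖ ^ 2 = ∑ i, ∑ j, M i j ^ 2 := by
  rw [Matrix.frobenius_norm_def, ← Real.sqrt_eq_rpow, Real.sq_sqrt (by positivity)]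
  simp

lemma norm_sub_submatrix_sq {n d : ℕ} (X Y : Matrix (Fin n) (Fin d) ℝ)
    (σ : Equiv.Perm (Fin n)) :
    ‖X - Y.submatrix σ id‖ ^ 2 = ∑ i, ‖rowVec X i - rowVec Y (σ i)‖ ^ 2 := by
  rw [frobenius_norm_sq]
  simp [EuclideanSpace.norm_sq_eq, rowVec]

/-- Sorting is a contraction modulo permutations. -/
lemma sum_sortVec_sub_sq_le {n : ℕ} (v w : Fin n → ℝ) (σ : Equiv.Perm (Fin n)) :
    ∑ i, (sortVec v i - sortVec w i) ^ 2 ≤ ∑ i, (v i - w (σ i)) ^ 2 := by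
  have hv : Monotone (sortVec v) := Tuple.monotone_sort v
  have hw : Monotone (sortVec w) := Tuple.monotone_sort w
  set τ : Equiv.Perm (Fin n) := (Tuple.sort v).trans (σ.trans (Tuple.sort w).symm) with hτ
  have h := (hv.monovary hw).sum_mul_comp_perm_le_sum_mul (σ := τ)
  have h1 : ∀ i, sortVec w (τ i) = w (σ (Tuple.sort v i)) := by
    intro i; simp [sortVec, hτ]
  have h2 : ∑ i, (v i - w (σ i)) ^ 2 = ∑ i, (sortVec v i - sortVec w (τ i)) ^ 2 := by
    simp_rw [h1]
    exact (Equiv.sum_comp (Tuple.sort v) (fun i => (v i - w (σ i)) ^ 2)).symm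
  have h3 : ∑ i, sortVec w (τ i) ^ 2 = ∑ i, sortVec w i ^ 2 :=
    Equiv.sum_comp τ (fun i => sortVec w i ^ 2)
  rw [h2]
  simp only [sub_sq, Finset.sum_add_distrib, Finset.sum_sub_distrib, h3]
  have h4 : ∀ f g : Fin n → ℝ, ∑ i, 2 * f i * g i = 2 * ∑ i, f i * g i := by
    intro f g; rw [Finset.mul_sum]; exact Finset.sum_congr rfl fun i _ => by ring
  rw [h4, h4 _ fun i => sortVec w (τ i)]
  linarith

/-- The distance between sorted vectors is attained by some permutation. -/
lemma exists_perm_sum_sortVec_sub_sq_eq {n : ℕ} (v w : Fin n → ℝ) :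
    ∃ σ : Equiv.Perm (Fin n),
      ∑ i, (sortVec v i - sortVec w i) ^ 2 = ∑ i, (v i - w (σ i)) ^ 2 := by
  refine ⟨(Tuple.sort v).symm.trans (Tuple.sort w), ?_⟩
  rw [← Equiv.sum_comp (Tuple.sort v) fun i =>
    (v i - w (((Tuple.sort v).symm.trans (Tuple.sort w)) i)) ^ 2]
  simp [sortVec]

lemma norm_beta_sub_sq {n d D : ℕ} (A : Matrix (Fin d) (Fin D) ℝ)
    (X Y : Matrix (Fin n) (Fin d) ℝ) :
    ‖beta A X - beta A Y‖ ^ 2 = ∑ k, ∑ i, (sortVec (X *ᵥ fun j => A j k) i -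
      sortVec (Y *ᵥ fun j => A j k) i) ^ 2 := by
  rw [frobenius_norm_sq, Finset.sum_comm]
  simp [beta]

lemma orbitDist_le {n d : ℕ} (X Y : Matrix (Fin n) (Fin d) ℝ) (σ : Equiv.Perm (Fin n)) :
    orbitDist X Y ≤ ‖X - Y.submatrix σ id‖ :=
  ciInf_le ⟨0, by rintro _ ⟨τ, rfl⟩; exact norm_nonneg _⟩ σ

lemma orbitDist_nonneg {n d : ℕ} (X Y : Matrix (Fin n) (Fin d) ℝ) : 0 ≤ orbitDist X Y :=
  le_ciInf fun _ => norm_nonneg _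

lemma exists_orbitDist_eq {n d : ℕ} (X Y : Matrix (Fin n) (Fin d) ℝ) :
    ∃ σ : Equiv.Perm (Fin n), orbitDist X Y = ‖X - Y.submatrix σ id‖ := by
  obtain ⟨σ, hσ⟩ := exists_eq_ciInf_of_finite
    (f := fun σ : Equiv.Perm (Fin n) => ‖X - Y.submatrix σ id‖)
  exact ⟨σ, hσ.symm⟩

lemma upperLip_le {n d D : ℕ} (A : Matrix (Fin d) (Fin D) ℝ) {c : ℝ} (hc : 0 ≤ c)
    (h : ∀ v, ∑ k, (inner ℝ v (colVec A k)) ^ 2 ≤ c ^ 2 * ‖v‖ ^ 2) :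
    upperLip n A ≤ c := by
  refine csInf_le ⟨0, fun C hC => hC.1⟩ ⟨hc, fun X Y => ?_⟩
  obtain ⟨σ, hσ⟩ := exists_orbitDist_eq X Y
  rw [hσ]
  refine abs_le_of_sq_le_sq' ?_ (by positivity) |>.2
  rw [norm_beta_sub_sq, mul_pow, norm_sub_submatrix_sq, Finset.mul_sum]
  calc _ ≤ ∑ k, ∑ i, ((X *ᵥ fun j => A j k) i - (Y *ᵥ fun j => A j k) (σ i)) ^ 2 :=
        Finset.sum_le_sum fun k _ => sum_sortVec_sub_sq_le _ _ σ
    _ = ∑ i, ∑ k, (inner ℝ (rowVec X i - rowVec Y (σ i)) (colVec A k)) ^ 2 := by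
        rw [Finset.sum_comm]
        simp only [mulVec_col_eq_inner, inner_sub_left]
    _ ≤ _ := Finset.sum_le_sum fun i _ => h _

lemma bddAbove_lowerLip {n d D : ℕ} (hn : 1 ≤ n) (hd : 1 ≤ d) (A : Matrix (Fin d) (Fin D) ℝ) :
    BddAbove {C : ℝ | 0 ≤ C ∧ ∀ X Y : Matrix (Fin n) (Fin d) ℝ,
      C * orbitDist X Y ≤ ‖beta A X - beta A Y‖} := by
  let X : Matrix (Fin n) (Fin d) ℝ := Matrix.of fun _ _ => 1
  have hX : X ≠ 0 := fun h => by
    have := congrFun (congrFun h ⟨0, hn⟩) ⟨0, hd⟩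
    simp [X] at this
  have hpos : 0 < orbitDist X 0 := by
    obtain ⟨σ, hσ⟩ := exists_orbitDist_eq X 0
    rw [hσ]
    simpa using hX
  refine ⟨‖beta A X - beta A 0‖ / orbitDist X 0, fun C hC => ?_⟩
  rw [le_div_iff₀ hpos]
  exact hC.2 X 0

open Classical in
/-- If few columns are almost orthogonal to any given direction, then `β_A` is lower Lipschitz. -/
lemma le_lowerLip {n d D : ℕ} (hn : 1 ≤ n) (hd : 1 ≤ d) (A : Matrix (Fin d) (Fin D) ℝ) {ε : ℝ}
    (hε : 0 ≤ ε)
    (h : ∀ v : EuclideanSpace ℝ (Fin d),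
      (n : ℝ) ^ 2 * (Finset.univ.filter fun k => |inner ℝ v (colVec A k)| < ε * ‖v‖).card
        ≤ 2 / 3 * D) :
    ε * √(D / 3) ≤ lowerLip n A := by
  refine le_csSup (bddAbove_lowerLip hn hd A) ⟨by positivity, fun X Y => ?_⟩
  refine abs_le_of_sq_le_sq' ?_ (norm_nonneg _) |>.2
  rw [mul_pow, mul_pow, Real.sq_sqrt (by positivity), norm_beta_sub_sq]
  let bad : Fin n × Fin n → Finset (Fin D) := fun p => Finset.univ.filter fun k =>
    |inner ℝ (rowVec X p.1 - rowVec Y p.2) (colVec A k)| < ε * ‖rowVec X p.1 - rowVec Y p.2‖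
  let B : Finset (Fin D) := Finset.univ.biUnion bad
  have hB : (B.card : ℝ) ≤ 2 / 3 * D := by
    have h1 : (B.card : ℝ) ≤ ∑ p, ((bad p).card : ℝ) := by
      exact_mod_cast Finset.card_biUnion_le
    have hn' : (0 : ℝ) < (n : ℝ) ^ 2 := by positivity
    have h2 : ∀ p, ((bad p).card : ℝ) ≤ 2 / 3 * D / (n : ℝ) ^ 2 := by
      intro p
      rw [le_div_iff₀ hn', mul_comm]
      exact h _
    calc (B.card : ℝ) ≤ ∑ p, ((bad p).card : ℝ) := h1
      _ ≤ ∑ p : Fin n × Fin n, 2 / 3 * D / (n : ℝ) ^ 2 := Finset.sum_le_sum fun p _ => h2 p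
      _ = 2 / 3 * D := by
        simp only [Finset.sum_const, Finset.card_univ, Fintype.card_prod, Fintype.card_fin,
          nsmul_eq_mul]
        push_cast
        field_simp
  have hgood : (D : ℝ) / 3 ≤ (Bᶜ.card : ℝ) := by
    have := Finset.card_add_card_compl B
    rw [Fintype.card_fin] at this
    have : (B.card : ℝ) + Bᶜ.card = D := by exact_mod_cast this
    linarith
  calc ε ^ 2 * (D / 3) * orbitDist X Y ^ 2
      ≤ ∑ k ∈ Bᶜ, ε ^ 2 * orbitDist X Y ^ 2 := by
        rw [Finset.sum_const, nsmul_eq_mul]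
        have : 0 ≤ ε ^ 2 * orbitDist X Y ^ 2 := by positivity
        nlinarith
    _ ≤ ∑ k ∈ Bᶜ, ∑ i, (sortVec (X *ᵥ fun j => A j k) i -
          sortVec (Y *ᵥ fun j => A j k) i) ^ 2 := by
        refine Finset.sum_le_sum fun k hk => ?_
        obtain ⟨σ, hσ⟩ := exists_perm_sum_sortVec_sub_sq_eq (X *ᵥ fun j => A j k)
          (Y *ᵥ fun j => A j k)
        rw [hσ]
        have h1 : orbitDist X Y ^ 2 ≤ ∑ i, ‖rowVec X i - rowVec Y (σ i)‖ ^ 2 := by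
          rw [← norm_sub_submatrix_sq]
          exact pow_le_pow_left₀ (orbitDist_nonneg X Y) (orbitDist_le X Y σ) 2
        refine (mul_le_mul_of_nonneg_left h1 (sq_nonneg ε)).trans ?_
        rw [Finset.mul_sum]
        refine Finset.sum_le_sum fun i _ => ?_
        rw [mulVec_col_eq_inner, mulVec_col_eq_inner, ← inner_sub_left, ← mul_pow,
          ← sq_abs (inner ℝ _ _)]
        refine pow_le_pow_left₀ (by positivity) ?_ 2
        have hk' : k ∉ bad (i, σ i) := fun hmem =>
          Finset.mem_compl.1 hk (Finset.mem_biUnion.2 ⟨_, Finset.mem_univ _, hmem⟩)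
        simpa [bad] using hk'
    _ ≤ _ := Finset.sum_le_sum_of_subset_of_nonneg (Finset.subset_univ _)
        fun k _ _ => by positivity

open Metric Set ENNReal in
/-- The uniform measure on the sphere is bounded by normalized volumes of cones. -/
lemma sphereUniform_le_volume_div {d : ℕ} (hd : 1 ≤ d) {S T : Set (EuclideanSpace ℝ (Fin d))}
    (hS : MeasurableSet S)
    (h : ∀ r : ℝ, 0 < r → r < 1 → ∀ x ∈ S, ‖x‖ = 1 → r • x ∈ T) :
    sphereUniform d S ≤ volume T / volume (ball (0 : EuclideanSpace ℝ (Fin d)) 1) := by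
  have hd0 : (d : ℝ≥0∞) ≠ 0 := by simp; omega
  have hS' : MeasurableSet ((Subtype.val : sphere (0 : EuclideanSpace ℝ (Fin d)) 1 → _) ⁻¹' S) :=
    measurable_subtype_coe hS
  rw [sphereUniform, Measure.map_apply measurable_subtype_coe hS, Measure.smul_apply,
    Measure.toSphere_apply_univ, Measure.toSphere_apply' _ hS', finrank_euclideanSpace_fin,
    smul_eq_mul, ENNReal.mul_inv (Or.inl hd0) (Or.inl (by simp)), ENNReal.div_eq_inv_mul]
  have h1 : volume (Ioo (0 : ℝ) 1 • (Subtype.val ''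
      ((Subtype.val : sphere (0 : EuclideanSpace ℝ (Fin d)) 1 → _) ⁻¹' S))) ≤ volume T := by
    refine measure_mono ?_
    rintro _ ⟨r, hr, _, ⟨x, hx, rfl⟩, rfl⟩
    exact h r hr.1 hr.2 x hx (by simp)
  calc _ = ((d : ℝ≥0∞)⁻¹ * d) * ((volume (ball (0 : EuclideanSpace ℝ (Fin d)) 1))⁻¹ *
        volume (Ioo (0 : ℝ) 1 • (Subtype.val ''
      ((Subtype.val : sphere (0 : EuclideanSpace ℝ (Fin d)) 1 → _) ⁻¹' S)))) := by ring
    _ ≤ _ := by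
      rw [ENNReal.inv_mul_cancel hd0 (by simp), one_mul]
      gcongr

lemma isProbabilityMeasure_sphereUniform {d : ℕ} (hd : 1 ≤ d) :
    IsProbabilityMeasure (sphereUniform d) := by
  have : Nonempty (Fin d) := ⟨⟨0, hd⟩⟩
  constructor
  rw [sphereUniform, Measure.map_apply measurable_subtype_coe MeasurableSet.univ]
  simp only [Set.preimage_univ, Measure.smul_apply, smul_eq_mul]
  exact ENNReal.inv_mul_cancel (fun h => Measure.toSphere_ne_zero
    (volume : Measure (EuclideanSpace ℝ (Fin d))) (Measure.measure_univ_eq_zero.1 h))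
    (measure_ne_top _ _)

lemma ae_norm_eq_one_sphereUniform (d : ℕ) : ∀ᵐ x ∂(sphereUniform d), ‖x‖ = 1 := by
  rw [sphereUniform, ae_map_iff measurable_subtype_coe.aemeasurable
    (measurableSet_eq_fun measurable_norm measurable_const)]
  exact Eventually.of_forall fun x => by simp

lemma volume_unit_ball_fin (m : ℕ) :
    volume (Metric.ball (0 : EuclideanSpace ℝ (Fin m)) 1) =
      ENNReal.ofReal (√Real.pi ^ m / Real.Gamma (m / 2 + 1)) := by
  rcases Nat.eq_zero_or_pos m with rfl | hm
  · rw [volume_euclideanSpace_eq_dirac]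
    simp
  · have : Nonempty (Fin m) := ⟨⟨0, hm⟩⟩
    rw [EuclideanSpace.volume_ball]
    simp

lemma exists_orthonormalBasis_zero_eq {m : ℕ} {u : EuclideanSpace ℝ (Fin (m + 1))}
    (hu : ‖u‖ = 1) :
    ∃ b : OrthonormalBasis (Fin (m + 1)) ℝ (EuclideanSpace ℝ (Fin (m + 1))), b 0 = u := by
  obtain ⟨b, hb⟩ := Orthonormal.exists_orthonormalBasis_extension_of_card_eq (𝕜 := ℝ)
    (E := EuclideanSpace ℝ (Fin (m + 1))) (ι := Fin (m + 1)) (by simp) (v := fun _ => u)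
    (s := {0}) (by
      constructor
      · intro i; simpa using hu
      · intro i j hij; exact absurd (Subsingleton.elim i j) hij)
  exact ⟨b, hb 0 rfl⟩

lemma volume_coordinate_slab_le (m : ℕ) (t : ℝ) :
    volume {x : EuclideanSpace ℝ (Fin (m + 1)) | ‖x‖ < 1 ∧ |x 0| < t} ≤
      ENNReal.ofReal (2 * t) * volume (Metric.ball (0 : EuclideanSpace ℝ (Fin m)) 1) := by
  let B : Set (Fin m → ℝ) := WithLp.toLp 2 ⁻¹' Metric.ball (0 : EuclideanSpace ℝ (Fin m)) 1
  have hB : volume B = volume (Metric.ball (0 : EuclideanSpace ℝ (Fin m)) 1) :=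
    (PiLp.volume_preserving_toLp (Fin m)).measure_preimage
      Metric.isOpen_ball.measurableSet.nullMeasurableSet
  have hBm : MeasurableSet B :=
    (PiLp.volume_preserving_toLp (Fin m)).measurable Metric.isOpen_ball.measurableSet
  have hpres := (volume_preserving_piFinSuccAbove (fun _ : Fin (m + 1) => ℝ) 0).comp
    (PiLp.volume_preserving_ofLp (Fin (m + 1)))
  calc _ ≤ volume ((MeasurableEquiv.piFinSuccAbove (fun _ : Fin (m + 1) => ℝ) 0 ∘
          (WithLp.ofLp : EuclideanSpace ℝ (Fin (m + 1)) → _)) ⁻¹' (Set.Ioo (-t) t ×ˢ B)) := by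
        refine measure_mono fun x hx => ?_
        refine ⟨abs_lt.1 hx.2, ?_⟩
        have h2 : ‖x‖ ^ 2 < 1 := by
          have := norm_nonneg x; nlinarith [hx.1]
        rw [EuclideanSpace.norm_sq_eq, Fin.sum_univ_succ] at h2
        have h3 : ‖WithLp.toLp 2 (fun i : Fin m => x i.succ)‖ ^ 2 < 1 := by
          rw [EuclideanSpace.norm_sq_eq]
          have := sq_nonneg ‖x 0‖
          simp only at h2 ⊢
          linarith
        have h4 : ‖WithLp.toLp 2 (fun i : Fin m => x i.succ)‖ < 1 := by
          by_contra! hc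
          nlinarith
        simpa [B] using! h4
    _ = volume (Set.Ioo (-t) t ×ˢ B) :=
        hpres.measure_preimage (measurableSet_Ioo.prod hBm).nullMeasurableSet
    _ = _ := by
        rw [Measure.volume_eq_prod, Measure.prod_prod, hB, Real.volume_Ioo]
        ring_nf

lemma volume_slab_le {m : ℕ} {u : EuclideanSpace ℝ (Fin (m + 1))} (hu : ‖u‖ = 1) (t : ℝ) :
    volume {x : EuclideanSpace ℝ (Fin (m + 1)) | ‖x‖ < 1 ∧ |inner ℝ u x| < t} ≤
      ENNReal.ofReal (2 * t) * volume (Metric.ball (0 : EuclideanSpace ℝ (Fin m)) 1) := by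
  obtain ⟨b, rfl⟩ := exists_orthonormalBasis_zero_eq hu
  refine le_trans (le_of_eq ?_) (volume_coordinate_slab_le m t)
  have hmeas : MeasurableSet {x : EuclideanSpace ℝ (Fin (m + 1)) | ‖x‖ < 1 ∧ |x 0| < t} :=
    (measurableSet_lt measurable_norm measurable_const).inter
      (measurableSet_lt (f := fun x : EuclideanSpace ℝ (Fin (m + 1)) => |x 0|)
        (by fun_prop) measurable_const)
  rw [← b.measurePreserving_repr.measure_preimage hmeas.nullMeasurableSet]
  congr 1
  ext x
  simp [b.repr_apply_apply]

lemma Gamma_add_half_le {s : ℝ} (hs : 0 < s) :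
    Real.Gamma (s + 1 / 2) ≤ √s * Real.Gamma s := by
  have h := Real.Gamma_mul_add_mul_le_rpow_Gamma_mul_rpow_Gamma hs (by linarith : 0 < s + 1)
    one_half_pos one_half_pos (by norm_num)
  have hG := Real.Gamma_pos_of_pos hs
  rw [Real.Gamma_add_one hs.ne', ← Real.sqrt_eq_rpow, ← Real.sqrt_eq_rpow,
    Real.sqrt_mul hs.le] at h
  calc _ = Real.Gamma (1 / 2 * s + 1 / 2 * (s + 1)) := by ring_nf
    _ ≤ _ := h
    _ = √s * (√(Real.Gamma s) * √(Real.Gamma s)) := by ring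
    _ = _ := by rw [Real.mul_self_sqrt hG.le]

/-- Anti-concentration of linear functionals on the sphere. -/
lemma sphereUniform_abs_inner_lt_le {d : ℕ} (hd : 1 ≤ d) {u : EuclideanSpace ℝ (Fin d)}
    (hu : ‖u‖ = 1) {t : ℝ} (ht : 0 ≤ t) :
    sphereUniform d {x | |inner ℝ u x| < t} ≤
      ENNReal.ofReal (t * √(2 * (d + 1) / Real.pi)) := by
  obtain ⟨m, rfl⟩ : ∃ m, d = m + 1 := ⟨d - 1, by omega⟩
  have hpi := Real.pi_pos
  refine (sphereUniform_le_volume_div hd (T := {x | ‖x‖ < 1 ∧ |inner ℝ u x| < t})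
    (isOpen_lt (by fun_prop) (by fun_prop)).measurableSet ?_).trans ?_
  · intro r hr0 hr1 x hx hx1
    refine ⟨by rw [norm_smul, hx1, Real.norm_of_nonneg hr0.le]; linarith, ?_⟩
    rw [inner_smul_right, abs_mul, abs_of_pos hr0]
    have : |inner ℝ u x| < t := hx
    nlinarith [abs_nonneg (inner ℝ u x)]
  · refine (ENNReal.div_le_div_right (volume_slab_le hu t) _).trans ?_
    have hG1 : 0 < Real.Gamma ((m : ℝ) / 2 + 1) := Real.Gamma_pos_of_pos (by positivity)
    have hG2 : 0 < Real.Gamma (((m + 1 : ℕ) : ℝ) / 2 + 1) := Real.Gamma_pos_of_pos (by positivity)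
    rw [volume_unit_ball_fin, volume_unit_ball_fin, ← ENNReal.ofReal_mul (by positivity),
      ← ENNReal.ofReal_div_of_pos (by positivity)]
    refine ENNReal.ofReal_le_ofReal ?_
    have h := Gamma_add_half_le (s := (m : ℝ) / 2 + 1) (by positivity)
    have he : (m : ℝ) / 2 + 1 + 1 / 2 = ((m + 1 : ℕ) : ℝ) / 2 + 1 := by push_cast; ring
    rw [he] at h
    have hsp : 0 < √Real.pi := Real.sqrt_pos.2 hpi
    have hs : √(2 * (((m + 1 : ℕ) : ℝ) + 1) / Real.pi) = 2 * √((m : ℝ) / 2 + 1) / √Real.pi := by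
      rw [Real.sqrt_div (by positivity)]
      congr 1
      rw [show (2 * (((m + 1 : ℕ) : ℝ) + 1)) = 2 ^ 2 * ((m : ℝ) / 2 + 1) by push_cast; ring,
        Real.sqrt_mul (by positivity), Real.sqrt_sq (by positivity)]
    rw [hs]
    calc _ = 2 * t / √Real.pi *
          (Real.Gamma (((m + 1 : ℕ) : ℝ) / 2 + 1) / Real.Gamma ((m : ℝ) / 2 + 1)) := by
          rw [pow_succ]; field_simp
      _ ≤ 2 * t / √Real.pi * √((m : ℝ) / 2 + 1) := by
          gcongr
          rwa [div_le_iff₀ hG1]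
      _ = _ := by ring

/-- A spherical cap around `u` of height at most `1 / √2` generates a cone contained in a small
ball. -/
lemma sphereUniform_cap_le_of_sq_le_half {d : ℕ} (hd : 1 ≤ d) {u : EuclideanSpace ℝ (Fin d)}
    (hu : ‖u‖ = 1) {s : ℝ} (hs : 0 ≤ s) (hs2 : s ^ 2 ≤ 1 / 2) :
    sphereUniform d {x | s ≤ inner ℝ u x} ≤ ENNReal.ofReal (Real.exp (-(d * s ^ 2 / 2))) := by
  have hr : 0 < √(1 - s ^ 2) := Real.sqrt_pos.2 (by linarith)
  refine (sphereUniform_le_volume_div hd (T := Metric.closedBall (s • u) √(1 - s ^ 2))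
    (isClosed_le (by fun_prop) (by fun_prop)).measurableSet ?_).trans ?_
  · intro r hr0 hr1 x hx hx1
    rw [Metric.mem_closedBall, dist_eq_norm]
    refine Real.le_sqrt_of_sq_le ?_
    rw [norm_sub_sq_real, norm_smul, norm_smul, hx1, hu, inner_smul_left, inner_smul_right,
      real_inner_comm]
    have hx' : s ≤ inner ℝ u x := hx
    simp only [Real.norm_eq_abs, mul_one, sq_abs, conj_trivial]
    have : r * s * s ≤ r * s * inner ℝ u x := by gcongr
    nlinarith [mul_pos hr0 (sub_pos.2 hr1), sq_nonneg s]
  · rw [Measure.addHaar_closedBall _ _ hr.le, ENNReal.mul_div_cancel_right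
      (Metric.measure_ball_pos _ _ one_pos).ne' measure_ball_lt_top.ne]
    refine ENNReal.ofReal_le_ofReal ?_
    rw [finrank_euclideanSpace_fin]
    have h1 : √(1 - s ^ 2) ≤ Real.exp (-(s ^ 2 / 2)) := by
      rw [Real.sqrt_le_left (Real.exp_pos _).le, ← Real.exp_nat_mul]
      have := Real.add_one_le_exp (-s ^ 2)
      refine le_trans (by linarith) (this.trans (le_of_eq ?_))
      congr 1; push_cast; ring
    refine (pow_le_pow_left₀ hr.le h1 d).trans (le_of_eq ?_)
    rw [← Real.exp_nat_mul]
    congr 1; ring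

lemma sphereUniform_cap_le {d : ℕ} (hd : 1 ≤ d) {u : EuclideanSpace ℝ (Fin d)}
    (hu : ‖u‖ = 1) {s : ℝ} (hs : 0 ≤ s) :
    sphereUniform d {x | s ≤ inner ℝ u x} ≤ ENNReal.ofReal (Real.exp (-(d * s ^ 2 / 4))) := by
  rcases le_or_gt (s ^ 2) (1 / 2) with h | h
  · refine (sphereUniform_cap_le_of_sq_le_half hd hu hs h).trans (ENNReal.ofReal_le_ofReal ?_)
    rw [Real.exp_le_exp]
    have : 0 ≤ d * s ^ 2 := by positivity
    linarith
  · rcases le_or_gt s 1 with h1 | h1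
    · have hs0 : √(1 / 2) ^ 2 = 1 / 2 := Real.sq_sqrt (by norm_num)
      have hle : √(1 / 2) ≤ s := Real.sqrt_le_iff.2 ⟨hs, h.le⟩
      refine (measure_mono fun x (hx : s ≤ inner ℝ u x) => hle.trans hx).trans
        ((sphereUniform_cap_le_of_sq_le_half hd hu (Real.sqrt_nonneg _) hs0.le).trans
          (ENNReal.ofReal_le_ofReal ?_))
      rw [Real.exp_le_exp, hs0]
      have : (d : ℝ) * s ^ 2 ≤ d * 1 := by gcongr; nlinarith
      linarith
    · refine le_trans (le_of_eq ?_) zero_le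
      rw [measure_eq_zero_iff_ae_notMem]
      filter_upwards [ae_norm_eq_one_sphereUniform d] with x hx hx2
      have := real_inner_le_norm u x
      rw [hu, hx] at this
      have hx' : s ≤ inner ℝ u x := hx2
      linarith

lemma sphereUniform_le_abs_inner_le {d : ℕ} (hd : 1 ≤ d) {u : EuclideanSpace ℝ (Fin d)}
    (hu : ‖u‖ = 1) {s : ℝ} (hs : 0 ≤ s) :
    sphereUniform d {x | s ≤ |inner ℝ u x|} ≤
      ENNReal.ofReal (2 * Real.exp (-(d * s ^ 2 / 4))) := by
  have hsub : {x | s ≤ |inner ℝ u x|} ⊆ {x | s ≤ inner ℝ u x} ∪ {x | s ≤ inner ℝ (-u) x} := by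
    intro x (hx : s ≤ |inner ℝ u x|)
    rcases le_abs.1 hx with h | h
    · exact Or.inl h
    · exact Or.inr (by simpa [inner_neg_left] using h)
  refine (measure_mono hsub).trans ((measure_union_le _ _).trans ?_)
  rw [two_mul, ENNReal.ofReal_add (Real.exp_pos _).le (Real.exp_pos _).le]
  exact add_le_add (sphereUniform_cap_le hd hu hs)
    (sphereUniform_cap_le hd (by rwa [norm_neg]) hs)

/-- Linear functionals on the sphere are sub-Gaussian with variance proxy of order `1 / d`. -/
lemma lintegral_exp_inner_sq_sphereUniform_le {d : ℕ} (hd : 1 ≤ d)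
    {u : EuclideanSpace ℝ (Fin d)} (hu : ‖u‖ = 1) :
    ∫⁻ x, ENNReal.ofReal (Real.exp (d / 8 * (inner ℝ u x) ^ 2)) ∂(sphereUniform d) ≤
      ENNReal.ofReal 3 := by
  have := isProbabilityMeasure_sphereUniform hd
  have hd' : (0 : ℝ) < d := by exact_mod_cast hd
  have hmeas : Measurable fun x : EuclideanSpace ℝ (Fin d) => (d : ℝ) / 8 * (inner ℝ u x) ^ 2 := by
    fun_prop
  have hlc := lintegral_comp_eq_lintegral_meas_le_mul (sphereUniform d)
    (f := fun x => (d : ℝ) / 8 * (inner ℝ u x) ^ 2) (g := Real.exp)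
    (Eventually.of_forall fun x => by simp only [Pi.zero_apply]; positivity) hmeas.aemeasurable
    (fun t _ => Real.continuous_exp.intervalIntegrable _ _)
    (Eventually.of_forall fun t => (Real.exp_pos t).le)
  simp only [integral_exp, Real.exp_zero] at hlc
  have htail : ∫⁻ t in Set.Ioi (0 : ℝ), sphereUniform d
      {x | t ≤ (d : ℝ) / 8 * (inner ℝ u x) ^ 2} * ENNReal.ofReal (Real.exp t) ≤
        ENNReal.ofReal 2 := by
    calc _ ≤ ∫⁻ t in Set.Ioi (0 : ℝ), ENNReal.ofReal (2 * Real.exp (-t)) := by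
          refine setLIntegral_mono (by fun_prop) fun t ht => ?_
          have ht0 : (0 : ℝ) < t := ht
          have hsub : {x | t ≤ (d : ℝ) / 8 * (inner ℝ u x) ^ 2} ⊆
              {x | √(8 * t / d) ≤ |inner ℝ u x|} := by
            intro x (hx : t ≤ (d : ℝ) / 8 * (inner ℝ u x) ^ 2)
            refine Real.sqrt_le_iff.2 ⟨abs_nonneg _, ?_⟩
            rw [sq_abs, div_le_iff₀ hd']
            linarith
          have hle := (measure_mono hsub).trans
            (sphereUniform_le_abs_inner_le hd hu (Real.sqrt_nonneg (8 * t / d)))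
          rw [Real.sq_sqrt (by positivity)] at hle
          refine (mul_le_mul_left hle _).trans (le_of_eq ?_)
          rw [← ENNReal.ofReal_mul (by positivity), mul_assoc, ← Real.exp_add]
          congr 3
          field_simp
          ring
      _ = _ := by
          rw [← ofReal_integral_eq_lintegral_ofReal
            ((integrableOn_exp_neg_Ioi 0).const_mul 2)
            (Eventually.of_forall fun t => by simp only [Pi.zero_apply]; positivity),
            integral_const_mul, integral_exp_neg_Ioi]
          simp
  calc _ = ∫⁻ x, (ENNReal.ofReal (Real.exp (d / 8 * (inner ℝ u x) ^ 2) - 1) + 1)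
        ∂(sphereUniform d) := by
        refine lintegral_congr fun x => ?_
        rw [← ENNReal.ofReal_one, ← ENNReal.ofReal_add (sub_nonneg.2 (Real.one_le_exp
          (by positivity))) zero_le_one]
        congr 1; ring
    _ = (∫⁻ x, ENNReal.ofReal (Real.exp (d / 8 * (inner ℝ u x) ^ 2) - 1)
        ∂(sphereUniform d)) + 1 := by
        rw [lintegral_add_right _ measurable_const]
        simp
    _ ≤ ENNReal.ofReal 2 + 1 := by rw [hlc]; gcongr
    _ = _ := by
        rw [← ENNReal.ofReal_one, ← ENNReal.ofReal_add (by norm_num) (by norm_num)]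
        norm_num

/-- A `δ`-separated subset of the unit sphere has at most `(1 + 2 / δ) ^ d` elements. -/
lemma card_le_of_separated_sphere {d : ℕ} {δ : ℝ} (hδ : 0 < δ)
    (N : Finset (EuclideanSpace ℝ (Fin d))) (hN : ∀ u ∈ N, ‖u‖ = 1)
    (hsep : ∀ u ∈ N, ∀ v ∈ N, u ≠ v → δ ≤ ‖u - v‖) :
    (N.card : ℝ) ≤ (1 + 2 / δ) ^ d := by
  let μ : Measure (EuclideanSpace ℝ (Fin d)) := volume
  have hdisj : Set.Pairwise (N : Set (EuclideanSpace ℝ (Fin d)))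
      (Function.onFun Disjoint fun c => Metric.ball c (δ / 2)) := by
    intro c hc e he hce
    apply Metric.ball_disjoint_ball
    rw [dist_eq_norm]
    linarith [hsep c hc e he hce]
  have hsub : ⋃ c ∈ N, Metric.ball c (δ / 2) ⊆ Metric.ball 0 (1 + δ / 2) := by
    refine Set.iUnion₂_subset fun x hx => Metric.ball_subset_ball' ?_
    rw [dist_zero_right, hN x hx]
    linarith
  have hvol := measure_mono (μ := μ) hsub
  rw [measure_biUnion_finset hdisj fun c _ => Metric.isOpen_ball.measurableSet] at hvol
  simp only [μ.addHaar_ball_of_pos _ (half_pos hδ), finrank_euclideanSpace_fin,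
    Finset.sum_const, nsmul_eq_mul] at hvol
  rw [μ.addHaar_ball_of_pos _ (by positivity : 0 < 1 + δ / 2), finrank_euclideanSpace_fin,
    ← mul_assoc, ENNReal.mul_le_mul_iff_left (Metric.measure_ball_pos _ _ one_pos).ne'
      measure_ball_lt_top.ne] at hvol
  have h := ENNReal.toReal_le_of_le_ofReal (by positivity) hvol
  rw [ENNReal.toReal_mul, ENNReal.toReal_ofReal (by positivity), ENNReal.toReal_natCast,
    ← le_div_iff₀ (by positivity), ← div_pow] at h
  refine h.trans (le_of_eq ?_)
  congr 1
  field_simp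
  ring

/-- The unit sphere has a `δ`-net of cardinality at most `(1 + 2 / δ) ^ d`. -/
lemma exists_sphere_net (d : ℕ) {δ : ℝ} (hδ : 0 < δ) :
    ∃ N : Finset (EuclideanSpace ℝ (Fin d)), (∀ u ∈ N, ‖u‖ = 1) ∧
      (∀ v : EuclideanSpace ℝ (Fin d), ‖v‖ = 1 → ∃ u ∈ N, ‖v - u‖ ≤ δ) ∧
      (N.card : ℝ) ≤ (1 + 2 / δ) ^ d := by
  classical
  let K : Set ℕ := {k | ∃ N : Finset (EuclideanSpace ℝ (Fin d)), (∀ u ∈ N, ‖u‖ = 1) ∧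
    (∀ u ∈ N, ∀ v ∈ N, u ≠ v → δ ≤ ‖u - v‖) ∧ N.card = k}
  have hK0 : K.Nonempty := ⟨0, ∅, by simp⟩
  have hKb : BddAbove K := by
    refine ⟨⌊(1 + 2 / δ) ^ d⌋₊, ?_⟩
    rintro k ⟨N, h1, h2, rfl⟩
    exact Nat.le_floor (card_le_of_separated_sphere hδ N h1 h2)
  obtain ⟨N, h1, h2, hcard⟩ := Nat.sSup_mem hK0 hKb
  refine ⟨N, h1, fun v hv => ?_, card_le_of_separated_sphere hδ N h1 h2⟩
  by_contra! hcon
  have hvN : v ∉ N := fun hmem => by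
    have := hcon v hmem
    simp at this
    linarith
  have hmem : N.card + 1 ∈ K := by
    refine ⟨insert v N, ?_, ?_, Finset.card_insert_of_notMem hvN⟩
    · intro u hu
      rcases Finset.mem_insert.1 hu with rfl | hu
      exacts [hv, h1 u hu]
    · intro u hu w hw huw
      rcases Finset.mem_insert.1 hu with rfl | hu' <;>
        rcases Finset.mem_insert.1 hw with rfl | hw'
      · exact absurd rfl huw
      · exact (hcon w hw').le
      · rw [norm_sub_rev]; exact (hcon u hu').le
      · exact h2 u hu' w hw' huw
  have := le_csSup hKb hmem
  omega

/-- Chernoff bound for sums of a function of independent identically distributed vectors. -/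
lemma measureReal_le_sum_le_pow_mul_exp {Ω E : Type*} [MeasurableSpace Ω] [MeasurableSpace E]
    {P : Measure Ω} [IsProbabilityMeasure P] {D : ℕ} {a : Fin D → Ω → E} {μ : Measure E}
    (hlaw : ∀ k, HasLaw (a k) μ P) (hind : iIndepFun a P) {g : E → ℝ} (hg : Measurable g)
    {M : ℝ} (hM : 0 ≤ M) (hint : ∫⁻ x, ENNReal.ofReal (Real.exp (g x)) ∂μ ≤ ENNReal.ofReal M)
    (s : ℝ) :
    P.real {ω | s ≤ ∑ k, g (a k ω)} ≤ M ^ D * Real.exp (-s) := by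
  have hgi : Integrable (fun x => Real.exp (g x)) μ :=
    ⟨(by fun_prop : Measurable fun x => Real.exp (g x)).aestronglyMeasurable,
      (hasFiniteIntegral_iff_ofReal (Eventually.of_forall fun x => (Real.exp_pos _).le)).2
        (hint.trans_lt ENNReal.ofReal_lt_top)⟩
  have hI : ∫ x, Real.exp (g x) ∂μ ≤ M := by
    rw [integral_eq_lintegral_of_nonneg_ae (Eventually.of_forall fun x => (Real.exp_pos _).le)
      hgi.aestronglyMeasurable]
    exact ENNReal.toReal_le_of_le_ofReal hM hint
  have hX : ∀ k, AEMeasurable (fun ω => g (a k ω)) P := fun k =>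
    hg.comp_aemeasurable (hlaw k).aemeasurable
  have hXind : iIndepFun (fun k ω => g (a k ω)) P := hind.comp (fun _ => g) fun _ => hg
  have hXint : ∀ k, Integrable (fun ω => Real.exp (1 * g (a k ω))) P := by
    intro k
    have h := hgi
    rw [← (hlaw k).map_eq] at h
    simpa [Function.comp_def] using h.comp_aemeasurable (hlaw k).aemeasurable
  have hmgf : ∀ k, mgf (fun ω => g (a k ω)) P 1 ≤ M := by
    intro k
    rw [mgf]
    simp only [one_mul]
    rw [← (hlaw k).integral_comp (f := fun x => Real.exp (g x)) hgi.aestronglyMeasurable] at hI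
    exact hI
  have hsumint : Integrable (fun ω => Real.exp (1 * (∑ k, fun ω => g (a k ω)) ω)) P := by
    by_contra hcon
    have hpos : 0 < ∏ k, mgf (fun ω => g (a k ω)) P 1 :=
      Finset.prod_pos fun k _ => mgf_pos (hXint k)
    rw [← hXind.mgf_sum₀ hX, mgf, integral_undef hcon] at hpos
    exact lt_irrefl _ hpos
  have hsum := measure_ge_le_exp_mul_mgf (μ := P) (X := ∑ k, fun ω => g (a k ω)) s zero_le_one
    hsumint
  rw [hXind.mgf_sum₀ hX] at hsum
  have hprod : ∏ k, mgf (fun ω => g (a k ω)) P 1 ≤ M ^ D := by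
    refine (Finset.prod_le_prod (fun k _ => mgf_nonneg) fun k _ => hmgf k).trans (le_of_eq ?_)
    simp
  calc _ = P.real {ω | s ≤ (∑ k, fun ω => g (a k ω)) ω} := by simp
    _ ≤ _ := hsum
    _ ≤ Real.exp (-1 * s) * M ^ D := by gcongr
    _ = _ := by rw [mul_comm]; simp

lemma ae_forall_norm_colVec_eq_one {Ω : Type*} [MeasurableSpace Ω] {P : Measure Ω} {d D : ℕ}
    {A : Ω → Matrix (Fin d) (Fin D) ℝ} (hA : HasIndepUniformSphereColumns A P) :
    ∀ᵐ ω ∂P, ∀ k, ‖colVec (A ω) k‖ = 1 := by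
  rw [ae_all_iff]
  intro k
  have h := ae_norm_eq_one_sphereUniform d
  rw [← (hA.1 k).map_eq] at h
  exact ae_of_ae_map (hA.1 k).aemeasurable h

lemma one_sub_le_measureReal {Ω : Type*} [MeasurableSpace Ω] (P : Measure Ω)
    [IsProbabilityMeasure P] {B G : Set Ω} {p : ℝ} (hB : P.real B ≤ p) (h : ∀ ω ∉ B, ω ∈ G) :
    1 - p ≤ P.real G := by
  have huniv : (Set.univ : Set Ω) ⊆ G ∪ B := fun ω _ => by
    by_cases hω : ω ∈ B
    exacts [Or.inr hω, Or.inl (h ω hω)]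
  have h1 : P.real Set.univ ≤ P.real (G ∪ B) := measureReal_mono huniv
  rw [probReal_univ] at h1
  linarith [measureReal_union_le (μ := P) G B]

lemma lintegral_exp_indicator_le {E : Type*} [MeasurableSpace E] {μ : Measure E}
    [IsProbabilityMeasure μ] {S : Set E} (hS : MeasurableSet S) {q : ℝ} (hq : 0 ≤ q)
    (h : μ S ≤ ENNReal.ofReal q) :
    ∫⁻ x, ENNReal.ofReal (Real.exp (S.indicator (fun _ => (1 : ℝ)) x)) ∂μ ≤
      ENNReal.ofReal (1 + 2 * q) := by
  calc _ ≤ ∫⁻ x, (1 + S.indicator (fun _ => (2 : ENNReal)) x) ∂μ := by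
        refine lintegral_mono fun x => ?_
        by_cases hx : x ∈ S
        · simp only [Set.indicator_of_mem hx]
          refine (ENNReal.ofReal_le_ofReal (Real.exp_one_lt_three.le)).trans (le_of_eq ?_)
          norm_num
        · simp [Set.indicator_of_notMem hx]
    _ = 1 + 2 * μ S := by
        rw [lintegral_add_left measurable_const, lintegral_indicator_const hS]
        simp
    _ ≤ 1 + 2 * ENNReal.ofReal q := by gcongr
    _ = _ := by
        rw [ENNReal.ofReal_add zero_le_one (by positivity), ENNReal.ofReal_mul zero_le_two]
        simp

open Classical in
/-- With high probability no direction is almost orthogonal to too many columns. -/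
lemma exists_exceptional_set_lower {Ω : Type*} [MeasurableSpace Ω] {P : Measure Ω}
    [IsProbabilityMeasure P] {d n D : ℕ} (hd : 1 ≤ d) (hn : 1 ≤ n)
    {A : Ω → Matrix (Fin d) (Fin D) ℝ} (hA : HasIndepUniformSphereColumns A P) {ε : ℝ}
    (hε : 0 < ε) (hq : 2 * ε * √(2 * (d + 1) / Real.pi) ≤ 1 / (8 * (n : ℝ) ^ 2))
    (hcard : (d : ℝ) * Real.log (1 + 2 / ε) ≤ D / (9 * (n : ℝ) ^ 2)) :
    ∃ B : Set Ω, P.real B ≤ Real.exp (-(D : ℝ) / (18 * (n : ℝ) ^ 2)) ∧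
      ∀ ω ∉ B, ∀ v : EuclideanSpace ℝ (Fin d), (n : ℝ) ^ 2 *
        (Finset.univ.filter fun k => |inner ℝ v (colVec (A ω) k)| < ε * ‖v‖).card
          ≤ 2 / 3 * D := by
  have hn' : (0 : ℝ) < (n : ℝ) ^ 2 := by positivity
  have := isProbabilityMeasure_sphereUniform hd
  obtain ⟨N, hN1, hNnet, hNcard⟩ := exists_sphere_net d hε
  let S : EuclideanSpace ℝ (Fin d) → Set (EuclideanSpace ℝ (Fin d)) := fun u =>
    {x | |inner ℝ u x| < 2 * ε}
  have hS : ∀ u, MeasurableSet (S u) := fun u =>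
    (isOpen_lt (by fun_prop) (by fun_prop)).measurableSet
  let g : EuclideanSpace ℝ (Fin d) → EuclideanSpace ℝ (Fin d) → ℝ := fun u =>
    (S u).indicator fun _ => 1
  let s : ℝ := 2 / 3 * D / (n : ℝ) ^ 2
  let bad : EuclideanSpace ℝ (Fin d) → Set Ω := fun u =>
    {ω | s ≤ ∑ k, g u (colVec (A ω) k)}
  have hbad : ∀ u ∈ N, P.real (bad u) ≤ Real.exp (-(3 * (D / (18 * (n : ℝ) ^ 2)))) := by
    intro u hu
    have hμ : sphereUniform d (S u) ≤ ENNReal.ofReal (1 / (8 * (n : ℝ) ^ 2)) :=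
      (sphereUniform_abs_inner_lt_le hd (hN1 u hu) (by positivity)).trans
        (ENNReal.ofReal_le_ofReal hq)
    refine (measureReal_le_sum_le_pow_mul_exp hA.1 hA.2
      (measurable_const.indicator (hS u)) (by positivity)
      (lintegral_exp_indicator_le (hS u) (by positivity) hμ) s).trans ?_
    have h1 : 1 + 2 * (1 / (8 * (n : ℝ) ^ 2)) ≤ Real.exp (1 / (4 * (n : ℝ) ^ 2)) := by
      refine le_trans (le_of_eq ?_) (Real.add_one_le_exp _)
      field_simp
      ring
    calc _ ≤ Real.exp (1 / (4 * (n : ℝ) ^ 2)) ^ D * Real.exp (-s) := by gcongr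
      _ = Real.exp (-(5 / 12 * (D / (n : ℝ) ^ 2))) := by
          rw [← Real.exp_nat_mul, ← Real.exp_add]
          congr 1
          simp only [s]
          field_simp
          ring
      _ ≤ _ := by
          rw [Real.exp_le_exp]
          have h2 : 0 ≤ (D : ℝ) / (n : ℝ) ^ 2 := by positivity
          have h3 : 3 * ((D : ℝ) / (18 * (n : ℝ) ^ 2)) = 1 / 6 * (D / (n : ℝ) ^ 2) := by
            field_simp; ring
          rw [h3]
          linarith
  let Z : Set Ω := {ω | ¬ ∀ k, ‖colVec (A ω) k‖ = 1}
  have hZ : P.real Z = 0 := by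
    rw [measureReal_def, ae_iff.1 (ae_forall_norm_colVec_eq_one hA)]
    rfl
  refine ⟨Z ∪ ⋃ u ∈ N, bad u, ?_, fun ω hω v => ?_⟩
  · calc _ ≤ P.real Z + P.real (⋃ u ∈ N, bad u) := measureReal_union_le _ _
      _ ≤ 0 + ∑ u ∈ N, P.real (bad u) :=
          add_le_add hZ.le (measureReal_biUnion_finset_le _ _)
      _ ≤ ∑ u ∈ N, Real.exp (-(3 * (D / (18 * (n : ℝ) ^ 2)))) := by
          rw [zero_add]; exact Finset.sum_le_sum hbad
      _ = N.card * Real.exp (-(3 * (D / (18 * (n : ℝ) ^ 2)))) := by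
          rw [Finset.sum_const, nsmul_eq_mul]
      _ ≤ Real.exp (2 * (D / (18 * (n : ℝ) ^ 2))) * Real.exp (-(3 * (D / (18 * (n : ℝ) ^ 2)))) := by
          gcongr
          refine hNcard.trans ?_
          rw [← Real.exp_log (by positivity : 0 < 1 + 2 / ε), ← Real.exp_nat_mul,
            Real.exp_le_exp]
          refine hcard.trans (le_of_eq ?_)
          field_simp
          ring
      _ = _ := by
          rw [← Real.exp_add]
          congr 1
          ring
  · simp only [Set.mem_union, Set.mem_iUnion, not_or, not_exists] at hω
    obtain ⟨hωZ, hωbad⟩ := hω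
    have hnorm : ∀ k, ‖colVec (A ω) k‖ = 1 := not_not.1 hωZ
    rcases eq_or_ne v 0 with rfl | hv
    · simp only [inner_zero_left, abs_zero, norm_zero, mul_zero, lt_self_iff_false,
        Finset.filter_false, Finset.card_empty, Nat.cast_zero]
      positivity
    · have hv' : 0 < ‖v‖ := norm_pos_iff.2 hv
      obtain ⟨u, hu, hvu⟩ := hNnet (‖v‖⁻¹ • v) (by
        rw [norm_smul, norm_inv, norm_norm, inv_mul_cancel₀ hv'.ne'])
      have hlt : ∑ k, g u (colVec (A ω) k) < s := not_le.1 (hωbad u hu)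
      have hle : ((Finset.univ.filter fun k =>
          |inner ℝ v (colVec (A ω) k)| < ε * ‖v‖).card : ℝ) ≤ ∑ k, g u (colVec (A ω) k) := by
        rw [Finset.card_filter]
        push_cast
        refine Finset.sum_le_sum fun k _ => ?_
        split_ifs with hk
        · have hmem : colVec (A ω) k ∈ S u := by
            change |inner ℝ u (colVec (A ω) k)| < 2 * ε
            have h1 : |inner ℝ (‖v‖⁻¹ • v) (colVec (A ω) k)| < ε := by
              rw [inner_smul_left, conj_trivial, abs_mul, abs_inv, abs_norm,
                inv_mul_lt_iff₀ hv', mul_comm]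
              exact hk
            have h2 : |inner ℝ (‖v‖⁻¹ • v - u) (colVec (A ω) k)| ≤ ε := by
              refine (abs_real_inner_le_norm _ _).trans ?_
              rw [hnorm k, mul_one]
              exact hvu
            have h3 : inner ℝ u (colVec (A ω) k) = inner ℝ (‖v‖⁻¹ • v) (colVec (A ω) k) -
                inner ℝ (‖v‖⁻¹ • v - u) (colVec (A ω) k) := by
              rw [inner_sub_left]; ring
            rw [h3]
            refine (abs_sub _ _).trans_lt ?_
            linarith
          exact (Set.indicator_of_mem hmem fun _ => (1 : ℝ)).ge
        · exact Set.indicator_nonneg (fun _ _ => zero_le_one) _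
      have := hle.trans hlt.le
      simp only [s] at this
      rw [le_div_iff₀ hn'] at this
      linarith

/-- A quadratic form bound on a `1/2`-net of the sphere extends to all vectors. -/
lemma sum_inner_sq_le_of_net {E : Type*} [NormedAddCommGroup E] [InnerProductSpace ℝ E] {D : ℕ}
    (a : Fin D → E) {N : Finset E} (hN : ∀ v : E, ‖v‖ = 1 → ∃ u ∈ N, ‖v - u‖ ≤ 1 / 2) {R : ℝ}
    (hR : 0 ≤ R) (h : ∀ u ∈ N, ∑ k, (inner ℝ u (a k)) ^ 2 ≤ R ^ 2) (v : E) :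
    ∑ k, (inner ℝ v (a k)) ^ 2 ≤ (2 * R) ^ 2 * ‖v‖ ^ 2 := by
  let L : E →L[ℝ] EuclideanSpace ℝ (Fin D) :=
    (PiLp.continuousLinearEquiv 2 ℝ fun _ : Fin D => ℝ).symm.toContinuousLinearMap.comp
      (ContinuousLinearMap.pi fun k => innerSL ℝ (a k))
  have hL : ∀ x, ‖L x‖ ^ 2 = ∑ k, (inner ℝ x (a k)) ^ 2 := by
    intro x
    rw [EuclideanSpace.norm_sq_eq]
    refine Finset.sum_congr rfl fun k _ => ?_
    rw [Real.norm_eq_abs, sq_abs, real_inner_comm]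
    rfl
  have hLN : ∀ u ∈ N, ‖L u‖ ≤ R := fun u hu =>
    abs_le_of_sq_le_sq' (by rw [hL]; exact h u hu) hR |>.2
  have hop : ‖L‖ ≤ R + ‖L‖ / 2 := by
    refine L.opNorm_le_bound (by positivity) fun x => ?_
    rcases eq_or_ne x 0 with rfl | hx
    · simp
    · have hx' : 0 < ‖x‖ := norm_pos_iff.2 hx
      obtain ⟨u, hu, hxu⟩ := hN (‖x‖⁻¹ • x) (by
        rw [norm_smul, norm_inv, norm_norm, inv_mul_cancel₀ hx'.ne'])
      have h1 : ‖L (‖x‖⁻¹ • x)‖ ≤ R + ‖L‖ / 2 := by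
        calc ‖L (‖x‖⁻¹ • x)‖ = ‖L u + L (‖x‖⁻¹ • x - u)‖ := by rw [← map_add]; congr 2; abel
          _ ≤ ‖L u‖ + ‖L (‖x‖⁻¹ • x - u)‖ := norm_add_le _ _
          _ ≤ R + ‖L‖ * (1 / 2) :=
            add_le_add (hLN u hu) ((L.le_opNorm _).trans (by gcongr))
          _ = _ := by ring
      rw [map_smul, norm_smul, norm_inv, norm_norm, inv_mul_le_iff₀ hx'] at h1
      linarith
  rw [← hL, ← mul_pow]
  refine pow_le_pow_left₀ (norm_nonneg _) ((L.le_opNorm v).trans ?_) 2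
  gcongr
  linarith

/-- With high probability the operator norm of a matrix with independent uniform spherical columns
is of order `√(D / d)`. -/
lemma exists_exceptional_set_upper {Ω : Type*} [MeasurableSpace Ω] {P : Measure Ω}
    [IsProbabilityMeasure P] {d D : ℕ} (hd : 1 ≤ d) (hdD : d ≤ D)
    {A : Ω → Matrix (Fin d) (Fin D) ℝ} (hA : HasIndepUniformSphereColumns A P) :
    ∃ B : Set Ω, P.real B ≤ Real.exp (-(D : ℝ)) ∧
      ∀ ω ∉ B, ∀ v : EuclideanSpace ℝ (Fin d),
        ∑ k, (inner ℝ v (colVec (A ω) k)) ^ 2 ≤ (2 * √(32 * D / d)) ^ 2 * ‖v‖ ^ 2 := by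
  have hd' : (0 : ℝ) < d := by exact_mod_cast hd
  obtain ⟨N, hN1, hNnet, hNcard⟩ := exists_sphere_net d (δ := 1 / 2) (by norm_num)
  let bad : EuclideanSpace ℝ (Fin d) → Set Ω := fun u =>
    {ω | 4 * (D : ℝ) ≤ ∑ k, (d : ℝ) / 8 * (inner ℝ u (colVec (A ω) k)) ^ 2}
  have hbad : ∀ u ∈ N, P.real (bad u) ≤ 3 ^ D * Real.exp (-(4 * (D : ℝ))) := fun u hu =>
    measureReal_le_sum_le_pow_mul_exp hA.1 hA.2
      (g := fun x => (d : ℝ) / 8 * (inner ℝ u x) ^ 2) (by fun_prop) (by norm_num)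
      (lintegral_exp_inner_sq_sphereUniform_le hd (hN1 u hu)) _
  refine ⟨⋃ u ∈ N, bad u, ?_, fun ω hω => ?_⟩
  · calc _ ≤ ∑ u ∈ N, P.real (bad u) := measureReal_biUnion_finset_le _ _
      _ ≤ ∑ u ∈ N, 3 ^ D * Real.exp (-(4 * (D : ℝ))) := Finset.sum_le_sum hbad
      _ = N.card * (3 ^ D * Real.exp (-(4 * (D : ℝ)))) := by
          rw [Finset.sum_const, nsmul_eq_mul]
      _ ≤ 5 ^ D * (3 ^ D * Real.exp (-(4 * (D : ℝ)))) := by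
          gcongr
          refine hNcard.trans ?_
          norm_num
          exact pow_le_pow_right₀ (by norm_num) hdD
      _ = 15 ^ D * Real.exp (-(4 * (D : ℝ))) := by
          rw [← mul_assoc, ← mul_pow]; norm_num
      _ ≤ Real.exp 3 ^ D * Real.exp (-(4 * (D : ℝ))) := by
          gcongr
          rw [show (3 : ℝ) = (3 : ℕ) * 1 by norm_num, Real.exp_nat_mul]
          have := Real.exp_one_gt_d9
          calc (15 : ℝ) ≤ 2.7 ^ 3 := by norm_num
            _ ≤ _ := by gcongr; linarith
      _ = _ := by
          rw [← Real.exp_nat_mul, ← Real.exp_add]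
          congr 1
          ring
  · simp only [Set.mem_iUnion, not_exists] at hω
    refine sum_inner_sq_le_of_net _ hNnet (Real.sqrt_nonneg _) fun u hu => ?_
    have h : ∑ k, (d : ℝ) / 8 * (inner ℝ u (colVec (A ω) k)) ^ 2 < 4 * (D : ℝ) :=
      not_le.1 (hω u hu)
    rw [← Finset.mul_sum] at h
    rw [Real.sq_sqrt (by positivity), le_div_iff₀ hd']
    linarith

/-- The effective dimension `d + 3 log (√6 n)` entering the lower Lipschitz bound. -/
def effDim (d n : ℕ) : ℝ := d + 3 * Real.log (√6 * n)

/-- The width of the slabs whose occupation by columns is controlled. -/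
def slabWidth (d n : ℕ) : ℝ := √Real.pi / (24 * (n : ℝ) ^ 2 * √(effDim d n))

/-- The bound on the distortion. -/
def distortionBound (n : ℕ) : ℝ :=
  24 * √384 / √Real.pi * ((n : ℝ) ^ 2 * √(1 + 3 * Real.log (√6 * n)))

lemma one_le_three_mul_log {n : ℕ} (hn : 1 ≤ n) : 1 ≤ 3 * Real.log (√6 * n) := by
  have hn' : (1 : ℝ) ≤ n := by exact_mod_cast hn
  have h6 : (2 : ℝ) ≤ √6 := Real.le_sqrt_of_sq_le (by norm_num)
  have h : Real.log 2 ≤ Real.log (√6 * n) :=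
    Real.log_le_log (by norm_num) (by nlinarith)
  linarith [Real.log_two_gt_d9]

lemma add_one_le_effDim (d : ℕ) {n : ℕ} (hn : 1 ≤ n) : (d : ℝ) + 1 ≤ effDim d n := by
  have := one_le_three_mul_log hn
  unfold effDim
  linarith

lemma effDim_pos (d : ℕ) {n : ℕ} (hn : 1 ≤ n) : 0 < effDim d n :=
  lt_of_lt_of_le (by positivity) (add_one_le_effDim d hn)

lemma slabWidth_pos (d : ℕ) {n : ℕ} (hn : 1 ≤ n) : 0 < slabWidth d n := by
  have := Real.pi_pos
  have := effDim_pos d hn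
  unfold slabWidth
  positivity

lemma slabWidth_mul_sqrt_le (d : ℕ) {n : ℕ} (hn : 1 ≤ n) :
    2 * slabWidth d n * √(2 * (d + 1) / Real.pi) ≤ 1 / (8 * (n : ℝ) ^ 2) := by
  have hn' : (0 : ℝ) < (n : ℝ) ^ 2 := by positivity
  have hpi := Real.sqrt_pos.2 Real.pi_pos
  have he := Real.sqrt_pos.2 (effDim_pos d hn)
  have h2 : √2 ≤ 3 / 2 := Real.sqrt_le_iff.2 ⟨by norm_num, by norm_num⟩
  have h1 : √(2 * (d + 1) / Real.pi) ≤ 3 / 2 * √(effDim d n) / √Real.pi := by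
    rw [Real.sqrt_div (by positivity), Real.sqrt_mul (by norm_num)]
    gcongr
    exact add_one_le_effDim d hn
  calc _ ≤ 2 * slabWidth d n * (3 / 2 * √(effDim d n) / √Real.pi) := by
        have := slabWidth_pos d hn
        gcongr
    _ = _ := by
        unfold slabWidth
        field_simp
        norm_num

lemma half_le_sqrt_effDim_div (d : ℕ) {n : ℕ} (hn : 1 ≤ n) :
    1 / 2 ≤ √(effDim d n) / √Real.pi := by
  have hpi := Real.sqrt_pos.2 Real.pi_pos
  have h1 : 1 ≤ √(effDim d n) := by
    rw [Real.one_le_sqrt]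
    have := add_one_le_effDim d hn
    have : (0 : ℝ) ≤ d := by positivity
    linarith
  have h2 : √Real.pi ≤ 2 := Real.sqrt_le_iff.2 ⟨by norm_num, by linarith [Real.pi_le_four]⟩
  rw [le_div_iff₀ hpi]
  linarith

lemma one_add_two_div_slabWidth_le (d : ℕ) {n : ℕ} (hn : 1 ≤ n) :
    1 + 2 / slabWidth d n ≤ (48 * √3 * n * √(effDim d n) / √Real.pi + 1) ^ 2 := by
  have hn' : (0 : ℝ) < (n : ℝ) := by positivity
  have hpi := Real.sqrt_pos.2 Real.pi_pos
  have he := Real.sqrt_pos.2 (effDim_pos d hn)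
  set w := √(effDim d n) / √Real.pi with hw
  have hw2 : 1 / 2 ≤ w := half_le_sqrt_effDim_div d hn
  have e1 : 2 / slabWidth d n = 48 * (n : ℝ) ^ 2 * w := by
    rw [hw]; unfold slabWidth; field_simp; norm_num
  have e2 : 48 * √3 * n * √(effDim d n) / √Real.pi = 48 * √3 * n * w := by rw [hw]; ring
  rw [e1, e2]
  have h3 : √3 ^ 2 = 3 := Real.sq_sqrt (by norm_num)
  have e3 : (48 * √3 * n * w + 1) ^ 2 = 6912 * (n : ℝ) ^ 2 * w ^ 2 + 96 * √3 * n * w + 1 := by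
    ring_nf
    rw [h3]
    ring
  have h4 : 0 ≤ 96 * √3 * n * w := by positivity
  have h5 : 48 * (n : ℝ) ^ 2 * w ≤ 6912 * (n : ℝ) ^ 2 * w ^ 2 := by
    have : 0 ≤ (n : ℝ) ^ 2 * w := by positivity
    nlinarith
  rw [e3]
  linarith

lemma half_le_log (d : ℕ) {n : ℕ} (hn : 1 ≤ n) :
    1 / 2 ≤ Real.log (48 * √3 * n * √(effDim d n) / √Real.pi + 1) := by
  have hn' : (1 : ℝ) ≤ n := by exact_mod_cast hn
  have h3 : 1 ≤ √3 := by rw [Real.one_le_sqrt]; norm_num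
  have hw := half_le_sqrt_effDim_div d hn
  have h1 : 2 ≤ 48 * √3 * n * √(effDim d n) / √Real.pi + 1 := by
    have : 48 * 1 * 1 * (1 / 2) ≤ 48 * √3 * n * (√(effDim d n) / √Real.pi) := by gcongr
    rw [mul_div_assoc]
    linarith
  have := Real.log_le_log (by norm_num) h1
  linarith [Real.log_two_gt_d9]

lemma slabWidth_mul_sqrt_eq (d D : ℕ) {n : ℕ} (hn : 1 ≤ n) :
    slabWidth d n * √(D / 3) = √Real.pi / (24 * √3) * effDim d n ^ (-1 / 2 : ℝ) *
      (√(D : ℝ) / (n : ℝ) ^ 2) := by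
  have he := effDim_pos d hn
  rw [show (-1 / 2 : ℝ) = -(1 / 2) by norm_num, Real.rpow_neg he.le, ← Real.sqrt_eq_rpow,
    Real.sqrt_div (by positivity)]
  unfold slabWidth
  field_simp

lemma isSoftO_distortionBound : IsSoftO distortionBound fun n => (n : ℝ) ^ 2 := by
  refine ⟨1, ?_⟩
  unfold distortionBound
  refine IsBigO.const_mul_left (IsBigO.mul (isBigO_refl _ _) ?_) _
  refine IsBigO.of_bound (4 + 3 * Real.log √6) ?_
  filter_upwards [eventually_ge_atTop 3] with n hn
  have hn' : (3 : ℝ) ≤ n := by exact_mod_cast hn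
  have hlog : 1 ≤ Real.log n := by
    rw [Real.le_log_iff_exp_le (by linarith)]
    exact Real.exp_one_lt_three.le.trans hn'
  have h6 : 0 ≤ Real.log √6 := Real.log_nonneg (by rw [Real.one_le_sqrt]; norm_num)
  have h1 := one_le_three_mul_log (n := n) (by omega)
  rw [Real.norm_of_nonneg (Real.sqrt_nonneg _), pow_one, Real.norm_of_nonneg (by linarith)]
  refine (Real.sqrt_le_iff.2 ⟨by linarith, ?_⟩ : _ ≤ 1 + 3 * Real.log (√6 * n)).trans ?_
  · nlinarith
  · rw [Real.log_mul (by positivity) (by positivity)]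
    nlinarith

lemma sqrt_div_slabWidth_le {d n D : ℕ} (hd : 1 ≤ d) (hn : 1 ≤ n) (hD : 1 ≤ D) :
    2 * √(32 * D / d) / (slabWidth d n * √(D / 3)) ≤ distortionBound n := by
  have hd' : (1 : ℝ) ≤ d := by exact_mod_cast hd
  have hD' : (0 : ℝ) < D := by positivity
  have hn' : (0 : ℝ) < (n : ℝ) ^ 2 := by positivity
  have hpi := Real.sqrt_pos.2 Real.pi_pos
  have he := Real.sqrt_pos.2 (effDim_pos d hn)
  have hw := slabWidth_pos d hn
  have e1 : 2 * √(32 * D / d) = √384 * √(D / 3) / √d := by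
    rw [← Real.sqrt_mul (by norm_num), ← Real.sqrt_div (by positivity),
      show (384 : ℝ) * (D / 3) / d = 2 ^ 2 * (32 * D / d) by ring,
      Real.sqrt_mul (by norm_num), Real.sqrt_sq (by norm_num)]
  have h3 : 0 < √((D : ℝ) / 3) := Real.sqrt_pos.2 (by positivity)
  have hsd : 0 < √(d : ℝ) := Real.sqrt_pos.2 (by linarith)
  have h4 : √(effDim d n) ≤ √(1 + 3 * Real.log (√6 * n)) * √d := by
    have := one_le_three_mul_log hn
    rw [← Real.sqrt_mul (by linarith)]
    refine Real.sqrt_le_sqrt ?_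
    unfold effDim
    nlinarith
  calc _ = 24 * √384 / √Real.pi * ((n : ℝ) ^ 2 * (√(effDim d n) / √d)) := by
        rw [e1]; unfold slabWidth; field_simp
    _ ≤ _ := by
        unfold distortionBound
        gcongr
        rwa [div_le_iff₀ hsd]

end SortEmbedding

end

theorem theorem3p5 :
    ∃ f : ℕ → ℝ, SortEmbedding.IsSoftO f (fun n => (n : ℝ) ^ 2) ∧
      ∀ (d n D : ℕ), 1 ≤ d → 1 ≤ n → 1 ≤ D →
      ∀ (Ω : Type*) [MeasurableSpace Ω] (P : MeasureTheory.Measure Ω)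
        [MeasureTheory.IsProbabilityMeasure P] (A : Ω → Matrix (Fin d) (Fin D) ℝ),
      SortEmbedding.HasIndepUniformSphereColumns A P →
      18 * (d : ℝ) * (n : ℝ) ^ 2 *
          Real.log (48 * √3 * (n : ℝ) * √((d : ℝ) + 3 * Real.log (√6 * (n : ℝ))) / √Real.pi + 1)
        ≤ (D : ℝ) →
      1 - Real.exp (-(D : ℝ) / (18 * (n : ℝ) ^ 2)) ≤
          P.real {ω | √Real.pi / (24 * √3) *
              ((d : ℝ) + 3 * Real.log (√6 * (n : ℝ))) ^ (-1 / 2 : ℝ) * (√(D : ℝ) / (n : ℝ) ^ 2)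
            ≤ SortEmbedding.lowerLip n (A ω)} ∧
      1 - 2 * Real.exp (-(D : ℝ)) - Real.exp (-(D : ℝ) / (18 * (n : ℝ) ^ 2)) ≤
          P.real {ω | 0 < SortEmbedding.lowerLip n (A ω) ∧
            SortEmbedding.distortion n (A ω) ≤ f n} := by
  refine ⟨SortEmbedding.distortionBound, SortEmbedding.isSoftO_distortionBound, ?_⟩
  intro d n D hd hn hD Ω _ P _ A hA hlarge
  have hlarge' : 18 * (d : ℝ) * (n : ℝ) ^ 2 * Real.log (48 * √3 * (n : ℝ) *
      √(SortEmbedding.effDim d n) / √Real.pi + 1) ≤ (D : ℝ) := hlarge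
  have hn' : (1 : ℝ) ≤ n := by exact_mod_cast hn
  have hn2 : (0 : ℝ) < (n : ℝ) ^ 2 := by positivity
  have hd' : (1 : ℝ) ≤ d := by exact_mod_cast hd
  have hw := SortEmbedding.slabWidth_pos d hn
  have hcard : (d : ℝ) * Real.log (1 + 2 / SortEmbedding.slabWidth d n) ≤
      D / (9 * (n : ℝ) ^ 2) := by
    have h := Real.log_le_log (by positivity) (SortEmbedding.one_add_two_div_slabWidth_le d hn)
    rw [Real.log_pow] at h
    push_cast at h
    rw [le_div_iff₀ (by positivity)]
    calc _ ≤ (d : ℝ) * (2 * Real.log (48 * √3 * (n : ℝ) *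
          √(SortEmbedding.effDim d n) / √Real.pi + 1)) * (9 * (n : ℝ) ^ 2) := by gcongr
      _ = _ := by ring
      _ ≤ _ := hlarge'
  have hdD : d ≤ D := by
    have h := SortEmbedding.half_le_log d hn
    have h1 : 18 * (d : ℝ) * 1 ^ 2 * (1 / 2) ≤ D := le_trans (by gcongr) hlarge'
    have h2 : (d : ℝ) ≤ D := by linarith
    exact_mod_cast h2
  obtain ⟨B, hB, hgood⟩ := SortEmbedding.exists_exceptional_set_lower hd hn hA hw
    (SortEmbedding.slabWidth_mul_sqrt_le d hn) hcard
  obtain ⟨B', hB', hgood'⟩ := SortEmbedding.exists_exceptional_set_upper hd hdD hA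
  have hlow : ∀ ω ∉ B, SortEmbedding.slabWidth d n * √(D / 3) ≤
      SortEmbedding.lowerLip n (A ω) := fun ω hω =>
    SortEmbedding.le_lowerLip hn hd (A ω) hw.le (hgood ω hω)
  refine ⟨SortEmbedding.one_sub_le_measureReal P hB fun ω hω => ?_, ?_⟩
  · exact (SortEmbedding.slabWidth_mul_sqrt_eq d D hn).symm.trans_le (hlow ω hω)
  · rw [sub_sub]
    refine SortEmbedding.one_sub_le_measureReal P (B := B' ∪ B) ?_ fun ω hω => ?_
    · have h1 := MeasureTheory.measureReal_union_le (μ := P) B' B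
      have h2 := Real.exp_pos (-(D : ℝ))
      linarith
    · rw [Set.mem_union, not_or] at hω
      have hpos : 0 < SortEmbedding.slabWidth d n * √((D : ℝ) / 3) :=
        mul_pos hw (Real.sqrt_pos.2 (by positivity))
      have hl := hlow ω hω.2
      refine ⟨hpos.trans_le hl, ?_⟩
      refine le_trans ?_ (SortEmbedding.sqrt_div_slabWidth_le hd hn hD)
      exact div_le_div₀ (by positivity)
        (SortEmbedding.upperLip_le (A ω) (by positivity) (hgood' ω hω.1)) hpos hl
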